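/- Let $t\ge 0$ be an integer. Two subsets $A,B$ of a linearly ordered set form an $(AB)^{t/2}$-sequence if there are $t$ elements $a_1<b_1<a_2<b_2<\cdots$ (alternating, starting with $a_1$) of the ordered set such that $\{a_1,a_2,\ldots\}\subseteq A\setminus B$ and $\{b_1,b_2,\ldots\}\subseteq B\setminus A$. A hypergraph (repeated hyperedges are allowed) is $(AB)^{t/2}$-free if its vertices have a linear ordering such that there are no two hyperedges $A$ and $B$ (in either order) that form an $(AB)^{t/2}$-sequence. A hypergraph is dual-$(AB)^{t/2}$-free if its dual, that is, the hypergraph obtained by reversing the roles of vertices and hyperedges, is $(AB)^{t/2}$-free. Corollary. For every integer $t\ge 0$ there exists a constant $c>0$ such that for every $n$, if $H$ is an $(AB)^{t/2}$-free hypergraph or a dual-$(AB)^{t/2}$-free hypergraph with $n$ vertices and $n$ hyperedges, then there exist a subset $V_0$ of its vertices and a subset $E_0$ of its hyperedges such that $|V_0|\ge cn$, $|E_0|\ge cn$, and either $v\in e$ for all $v\in V_0$, $e\in E_0$, or $v\notin e$ for all $v\in V_0$, $e\in E_0$. -/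

import Mathlib

/-- A hypergraph with vertex set `V` and hyperedges labelled by `E`; the hyperedge with label `e` is
the set `H.edge e` of vertices. Several labels may carry the same vertex set. (This is needed for
duals: two vertices lying in the same hyperedges give two equal hyperedges of the dual. A hypergraph
without repeated hyperedges is the case in which `H.edge` is injective.) -/
structure MultiHypergraph (V : Type*) (E : Type*) where
  /-- The set of vertices of the hyperedge with a given label. -/
  edge : E → Set V

/-- Two subsets `A`, `B` of an ordered set form an `(AB)^{t/2}`-sequence: there are `t` elements
`a₁ < b₁ < a₂ < b₂ < ⋯` with all `aᵢ` in `A \ B` and all `bᵢ` in `B \ A`. With positions counted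
from `0`, the `aᵢ` are at the even positions and the `bᵢ` at the odd ones. -/
def FormABSequence {V : Type*} [LinearOrder V] (t : ℕ) (A B : Set V) : Prop :=
  ∃ x : Fin t → V, StrictMono x ∧
    (∀ i : Fin t, Even (i : ℕ) → x i ∈ A \ B) ∧ (∀ i : Fin t, Odd (i : ℕ) → x i ∈ B \ A)

namespace MultiHypergraph

variable {V : Type*} {E : Type*}

/-- The dual hypergraph: the roles of vertices and hyperedges are reversed. -/
def dual (H : MultiHypergraph V E) : MultiHypergraph E V where
  edge v := {e | v ∈ H.edge e}

/-- A hypergraph with an ordered vertex set is `(AB)^{t/2}`-free: no two hyperedges, taken in either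
order, form an `(AB)^{t/2}`-sequence. -/
def IsOrderedABFree [LinearOrder V] (H : MultiHypergraph V E) (t : ℕ) : Prop :=
  ¬ ∃ e f : E, e ≠ f ∧ FormABSequence t (H.edge e) (H.edge f)

/-- A hypergraph with an unordered vertex set is `(AB)^{t/2}`-free: it is so for some linear order
of its vertices. -/
def IsABFree (H : MultiHypergraph V E) (t : ℕ) : Prop :=
  ∃ _ : LinearOrder V, H.IsOrderedABFree t

/-- A hypergraph is dual-`(AB)^{t/2}`-free if its dual is `(AB)^{t/2}`-free. -/
def IsDualABFree (H : MultiHypergraph V E) (t : ℕ) : Prop :=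
  H.dual.IsABFree t

end MultiHypergraph

/-!
The argument is an `ε`-net (or cutting) argument for a random sample of hyperedges.

Fix a linear order of the vertices witnessing that `H` is `(AB)^{t/2}`-free. For two hyperedges
`e`, `f` the length of the longest alternating sequence below a vertex `v` is monotone in `v` and
takes at most `t + 1` values, and on each of its level sets one of `e`, `f` contains the other
(`exists_monotone_level`). Hence a sample `σ` of `s` hyperedges cuts the vertices into boundedly
many cells (`sampleCell`): a cell is given by an interval on which the sampled hyperedges form a
chain, and by a position in that chain. The interval is cut out by two pairs of sampled hyperedges
and the position in the chain by two more sampled hyperedges, so every cell is determined by six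
hyperedges of the sample (`exists_sampleCell_eq`).

No sampled hyperedge splits a cell. If the cell of a vertex were split by more than half of all
hyperedges, then the `s - 6` sampled hyperedges not used to define the cell would all have to miss
this majority, which happens for at most a fraction `s ^ 6 * 2 ^ (6 - s)` of all samples
(`card_samples_missing`, `card_heavy_samples`). For `s = 64` this is below one half, so for some
sample at least half of the vertices lie in cells split by at most half of the hyperedges. The
largest of these cells has linear size, and at least a quarter of the hyperedges contain it or at
least a quarter of them avoid it. The dual case is the same statement with the roles of vertices
and hyperedges exchanged.
-/

/-! ### Level functions of pairs of hyperedges -/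

/-- In an alternating sequence of maximal length below `v`, the vertex `v` itself cannot prolong the
sequence; so the parity of the maximal length says which of `A \ B` and `B \ A` does not
contain `v`. -/
theorem exists_monotone_level {V : Type*} [LinearOrder V] {t : ℕ} {A B : Set V}
    (h : ¬ FormABSequence t A B) :
    ∃ α : V → Fin (t + 1), Monotone α ∧
      ∀ k, (∀ u, α u = k → u ∈ A → u ∈ B) ∨ (∀ u, α u = k → u ∈ B → u ∈ A) := by
  classical
  let P : V → ℕ → Prop := fun v r => ∃ x : Fin r → V, StrictMono x ∧
    (∀ i : Fin r, Even (i : ℕ) → x i ∈ A \ B) ∧ (∀ i : Fin r, Odd (i : ℕ) → x i ∈ B \ A) ∧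
    ∀ i, x i ≤ v
  have hP0 : ∀ v, P v 0 := fun v =>
    ⟨Fin.elim0, fun i => i.elim0, fun i => i.elim0, fun i => i.elim0, fun i => i.elim0⟩
  have hPt : ∀ v, ¬ P v t := fun v ⟨x, h1, h2, h3, _⟩ => h ⟨x, h1, h2, h3⟩
  have hmax : ∀ v, P v (Nat.findGreatest (P v) t) := fun v =>
    Nat.findGreatest_spec (Nat.zero_le t) (hP0 v)
  have hlt : ∀ v, Nat.findGreatest (P v) t < t := fun v =>
    lt_of_le_of_ne (Nat.findGreatest_le t) fun he => hPt v (by have := hmax v; rwa [he] at this)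
  have hnext : ∀ v, ¬ P v (Nat.findGreatest (P v) t + 1) := fun v =>
    Nat.findGreatest_is_greatest (Nat.lt_succ_self _) (hlt v)
  refine ⟨fun v => ⟨Nat.findGreatest (P v) t, (hlt v).trans (Nat.lt_succ_self t)⟩, ?_, ?_⟩
  · intro u v huv
    refine Nat.le_findGreatest (Nat.findGreatest_le t) ?_
    obtain ⟨x, h1, h2, h3, h4⟩ := hmax u
    exact ⟨x, h1, h2, h3, fun i => (h4 i).trans huv⟩
  -- A vertex of the type that comes next in a maximal sequence below it would prolong the sequence.
  have hext : ∀ (v : V) (r : ℕ), P v r → (Even r → v ∈ A \ B) → (Odd r → v ∈ B \ A) →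
      P v (r + 1) := by
    rintro v r ⟨x, h1, h2, h3, h4⟩ he ho
    have hlast : ∀ i : Fin r, (i : ℕ) + 1 = r → x i < v := by
      intro i hi
      refine lt_of_le_of_ne (h4 i) ?_
      rintro rfl
      rcases Nat.even_or_odd r with hr | hr
      · have hi' : Odd (i : ℕ) := by
          rw [← hi, Nat.even_add_one] at hr; exact Nat.not_even_iff_odd.1 hr
        exact (h3 i hi').2 (he hr).1
      · have hi' : Even (i : ℕ) := by
          rw [← hi, Nat.odd_add_one] at hr; exact Nat.not_odd_iff_even.1 hr
        exact (h2 i hi').2 (ho hr).1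
    have hall : ∀ i : Fin r, x i < v := by
      intro i
      have hr : 0 < r := i.pos
      exact (h1.monotone (show i ≤ ⟨r - 1, by omega⟩ from by
        rw [Fin.le_def]; have := i.isLt; simp only; omega)).trans_lt
          (hlast ⟨r - 1, by omega⟩ (by simp only; omega))
    refine ⟨Fin.snoc x v, ?_, ?_, ?_, ?_⟩
    · intro i j hij
      induction j using Fin.lastCases with
      | last =>
        induction i using Fin.lastCases with
        | last => exact absurd hij (lt_irrefl _)
        | cast i => simpa using hall i
      | cast j =>
        induction i using Fin.lastCases with
        | last => exact absurd hij (not_lt.2 (Fin.le_last _))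
        | cast i => simpa using h1 (by simpa using hij)
    · intro i
      induction i using Fin.lastCases with
      | last => simpa using he
      | cast i => simpa using h2 i
    · intro i
      induction i using Fin.lastCases with
      | last => simpa using ho
      | cast i => simpa using h3 i
    · intro i
      induction i using Fin.lastCases with
      | last => simp
      | cast i => simpa using h4 i
  intro k
  rcases Nat.even_or_odd (k : ℕ) with hk | hk
  · refine Or.inl fun u hu hA => ?_
    by_contra hB
    have hu' : Nat.findGreatest (P u) t = k := congrArg Fin.val hu
    refine hnext u (hext u _ (hmax u) (fun _ => ⟨hA, hB⟩) fun ho => ?_)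
    rw [hu'] at ho
    exact absurd hk (Nat.not_even_iff_odd.2 ho)
  · refine Or.inr fun u hu hB => ?_
    by_contra hA
    have hu' : Nat.findGreatest (P u) t = k := congrArg Fin.val hu
    refine hnext u (hext u _ (hmax u) (fun he => ?_) fun _ => ⟨hB, hA⟩)
    rw [hu'] at he
    exact absurd hk (Nat.not_odd_iff_even.2 he)

/-! ### Cells of a sample of hyperedges -/

/-- A finite nonempty family of pairwise comparable sets has a smallest member. -/
theorem exists_forall_subset_of_comparable {V κ : Type*} [Finite V] [Finite κ] [Nonempty κ]
    (F : κ → Set V) (h : ∀ a b, F a ⊆ F b ∨ F b ⊆ F a) : ∃ a, ∀ b, F a ⊆ F b := by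
  obtain ⟨a, ha⟩ := Finite.exists_min fun a => (F a).ncard
  refine ⟨a, fun b => (h a b).elim id fun hba => ?_⟩
  exact (Set.eq_of_subset_of_ncard_le hba (ha b)).ge

section Cells

variable {V E ι T : Type*} [LinearOrder T]

/-- The cell of the vertex `v` with respect to the sample `σ` of hyperedges: the vertices that have
the same levels as `v` for all pairs of sampled hyperedges and lie in the same sampled
hyperedges. -/
def sampleCell (edge : E → Set V) (α : E → E → V → T) (σ : ι → E) (v : V) : Set V :=
  {u | (∀ i j, α (σ i) (σ j) u = α (σ i) (σ j) v) ∧ ∀ i, u ∈ edge (σ i) ↔ v ∈ edge (σ i)}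

/-- The cell of `v` cut out by six hyperedges: the pair `q 0, q 1` bounds it from the left, the pair
`q 2, q 3` from the right, `q 4` from above and `q 5` from below. If `v` is not in `q 4`, or is
in `q 5`, the corresponding bound is void. -/
def sixEdgeCell (edge : E → Set V) (α : E → E → V → T) (q : Fin 6 → E) (v : V) : Set V :=
  {u | α (q 0) (q 1) v ≤ α (q 0) (q 1) u ∧ α (q 2) (q 3) u ≤ α (q 2) (q 3) v ∧
    (v ∈ edge (q 4) → u ∈ edge (q 4)) ∧ (u ∈ edge (q 5) → v ∈ edge (q 5))}

theorem exists_sampleCell_eq [LinearOrder V] [Finite V] [Finite ι] [Nonempty ι]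
    {edge : E → Set V} {α : E → E → V → T} (hmono : ∀ e f, Monotone (α e f))
    (hcomp : ∀ e f k, (∀ u, α e f u = k → u ∈ edge e → u ∈ edge f) ∨
      (∀ u, α e f u = k → u ∈ edge f → u ∈ edge e))
    (σ : ι → E) (v : V) :
    ∃ p : Fin 6 → ι, sampleCell edge α σ v = sixEdgeCell edge α (σ ∘ p) v := by
  obtain ⟨⟨a₀, a₁⟩, ha⟩ := exists_forall_subset_of_comparable
    (fun q : ι × ι => {u | α (σ q.1) (σ q.2) v ≤ α (σ q.1) (σ q.2) u})
    fun a b => IsUpperSet.total (fun x y hxy hx => le_trans hx (hmono _ _ hxy))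
      (fun x y hxy hx => le_trans hx (hmono _ _ hxy))
  obtain ⟨⟨b₀, b₁⟩, hb⟩ := exists_forall_subset_of_comparable
    (fun q : ι × ι => {u | α (σ q.1) (σ q.2) u ≤ α (σ q.1) (σ q.2) v})
    fun a b => IsLowerSet.total (fun x y hxy hx => le_trans (hmono _ _ hxy) hx)
      (fun x y hxy hx => le_trans (hmono _ _ hxy) hx)
  -- On the interval `I` around `v` the sampled hyperedges form a chain.
  let I : Set V := {u | ∀ i j, α (σ i) (σ j) u = α (σ i) (σ j) v}
  have hI : ∀ i j, (∀ u ∈ I, u ∈ edge (σ i) → u ∈ edge (σ j)) ∨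
      (∀ u ∈ I, u ∈ edge (σ j) → u ∈ edge (σ i)) := fun i j =>
    (hcomp (σ i) (σ j) (α (σ i) (σ j) v)).imp (fun h u hu => h u (hu i j))
      fun h u hu => h u (hu i j)
  obtain ⟨c, hc⟩ := exists_forall_subset_of_comparable
    (fun i : ι => {u | u ∈ I ∧ (v ∈ edge (σ i) → u ∈ edge (σ i))}) fun i j => by
      by_cases hi : v ∈ edge (σ i)
      · by_cases hj : v ∈ edge (σ j)
        · exact (hI i j).imp (fun h u hu => ⟨hu.1, fun _ => h u hu.1 (hu.2 hi)⟩)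
            fun h u hu => ⟨hu.1, fun _ => h u hu.1 (hu.2 hj)⟩
        · exact Or.inl fun u hu => ⟨hu.1, fun h => absurd h hj⟩
      · exact Or.inr fun u hu => ⟨hu.1, fun h => absurd h hi⟩
  obtain ⟨d, hd⟩ := exists_forall_subset_of_comparable
    (fun i : ι => {u | u ∈ I ∧ (u ∈ edge (σ i) → v ∈ edge (σ i))}) fun i j => by
      by_cases hi : v ∈ edge (σ i)
      · exact Or.inr fun u hu => ⟨hu.1, fun _ => hi⟩
      · by_cases hj : v ∈ edge (σ j)
        · exact Or.inl fun u hu => ⟨hu.1, fun _ => hj⟩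
        · exact (hI j i).imp (fun h u hu => ⟨hu.1, fun hu' => absurd (hu.2 (h u hu.1 hu')) hi⟩)
            fun h u hu => ⟨hu.1, fun hu' => absurd (hu.2 (h u hu.1 hu')) hj⟩
  refine ⟨![a₀, a₁, b₀, b₁, c, d], Set.Subset.antisymm ?_ ?_⟩
  · rintro u ⟨h1, h2⟩
    exact ⟨(h1 _ _).ge, (h1 _ _).le, (h2 _).2, (h2 _).1⟩
  · rintro u ⟨h1, h2, h3, h4⟩
    have hu : u ∈ I := fun i j => le_antisymm (hb (i, j) h2) (ha (i, j) h1)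
    exact ⟨hu, fun i => ⟨(hd i ⟨hu, h4⟩).2, (hc i ⟨hu, h3⟩).2⟩⟩

end Cells

/-! ### Counting samples -/

/-- Among all samples of `s` elements of `E`, those that avoid a set which is determined by the
`k` sampled elements at the positions `p`, and contains more than half of `E`, make up a fraction of
at most `2 ^ (k - s)`. -/
theorem card_samples_missing {E : Type*} [Fintype E] [DecidableEq E] {k s : ℕ}
    (D : (Fin k → E) → Finset E) (p : Fin k → Fin s) :
    (Finset.univ.filter fun σ : Fin s → E =>
      Fintype.card E < 2 * (D (σ ∘ p)).card ∧ ∀ j, σ j ∉ D (σ ∘ p)).card * 2 ^ s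
      ≤ 2 ^ k * Fintype.card E ^ s := by
  classical
  set B := Finset.univ.filter fun σ : Fin s → E =>
      Fintype.card E < 2 * (D (σ ∘ p)).card ∧ ∀ j, σ j ∉ D (σ ∘ p)
  set P : Finset (Fin s) := Finset.univ.image p
  set n := Fintype.card E
  have hPk : P.card ≤ k := by simpa using (Finset.card_image_le (s := Finset.univ) (f := p))
  have hPs : P.card + Pᶜ.card = s := by simp
  -- Once the entries in `P` are fixed, the other entries range over the complement of a fixed set.
  have hfib : ∀ a : P → E,
      (B.filter fun σ => (fun j : P => σ j) = a).card * 2 ^ Pᶜ.card ≤ n ^ Pᶜ.card := by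
    intro a
    rcases (B.filter fun σ => (fun j : P => σ j) = a).eq_empty_or_nonempty with h0 | ⟨τ, hτ⟩
    · simp [h0]
    obtain ⟨hτB, rfl⟩ := Finset.mem_filter.1 hτ
    have hsub : (B.filter fun σ => (fun j : P => σ j) = fun j : P => τ j) ⊆
        Fintype.piFinset fun j => if j ∈ P then {τ j} else (D (τ ∘ p))ᶜ := by
      intro σ hσ
      obtain ⟨hσB, hστ⟩ := Finset.mem_filter.1 hσ
      have heq : ∀ j ∈ P, σ j = τ j := fun j hj => congrFun hστ ⟨j, hj⟩
      have hcomp : σ ∘ p = τ ∘ p :=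
        funext fun i => heq _ (Finset.mem_image_of_mem p (Finset.mem_univ i))
      refine Fintype.mem_piFinset.2 fun j => ?_
      split_ifs with hj
      · exact Finset.mem_singleton.2 (heq j hj)
      · rw [Finset.mem_compl, ← hcomp]
        exact (Finset.mem_filter.1 hσB).2.2 j
    have hcard : (Fintype.piFinset fun j => if j ∈ P then {τ j} else (D (τ ∘ p))ᶜ).card =
        (D (τ ∘ p))ᶜ.card ^ Pᶜ.card := by
      rw [Fintype.card_piFinset, ← Finset.prod_mul_prod_compl P,
        Finset.prod_congr rfl fun j hj => by rw [if_pos hj, Finset.card_singleton],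
        Finset.prod_const_one, one_mul, ← Finset.prod_const]
      exact Finset.prod_congr rfl fun j hj => by rw [if_neg (Finset.mem_compl.1 hj)]
    have hD : (D (τ ∘ p))ᶜ.card * 2 ≤ n := by
      have h1 := (Finset.mem_filter.1 hτB).2.1
      have h2 := Finset.card_add_card_compl (D (τ ∘ p))
      omega
    calc _ ≤ (D (τ ∘ p))ᶜ.card ^ Pᶜ.card * 2 ^ Pᶜ.card :=
          Nat.mul_le_mul_right _ (hcard ▸ Finset.card_le_card hsub)
      _ = ((D (τ ∘ p))ᶜ.card * 2) ^ Pᶜ.card := (mul_pow _ _ _).symm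
      _ ≤ n ^ Pᶜ.card := Nat.pow_le_pow_left hD _
  have hsum : B.card * 2 ^ Pᶜ.card ≤ n ^ s := by
    rw [Finset.card_eq_sum_card_fiberwise (f := fun (σ : Fin s → E) (j : P) => σ j)
      (t := Finset.univ) fun _ _ => Finset.mem_coe.2 (Finset.mem_univ _), Finset.sum_mul]
    calc _ ≤ ∑ _a : P → E, n ^ Pᶜ.card := Finset.sum_le_sum fun a _ => hfib a
      _ = n ^ s := by
        rw [Finset.sum_const, Finset.card_univ, Fintype.card_fun, Fintype.card_coe, smul_eq_mul,
          ← pow_add, hPs]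
  calc B.card * 2 ^ s = 2 ^ P.card * (B.card * 2 ^ Pᶜ.card) := by
        rw [← congrArg (2 ^ ·) hPs]
        simp only [pow_add]
        ring
    _ ≤ 2 ^ k * n ^ s := Nat.mul_le_mul (Nat.pow_le_pow_right two_pos hPk) hsum

open Classical in
/-- The hyperedges that split a set `C` containing `v`: they contain exactly one of `v` and some
other element of `C`. -/
noncomputable def splittingEdges {V E : Type*} [Fintype E] (edge : E → Set V) (C : Set V) (v : V) :
    Finset E :=
  Finset.univ.filter fun e => ∃ u ∈ C, ¬ (u ∈ edge e ↔ v ∈ edge e)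

theorem mem_splittingEdges {V E : Type*} [Fintype E] {edge : E → Set V} {C : Set V} {v : V}
    {e : E} : e ∈ splittingEdges edge C v ↔ ∃ u ∈ C, ¬ (u ∈ edge e ↔ v ∈ edge e) := by
  simp [splittingEdges]

open Classical in
/-- A sample whose cell around `v` is split by more than half of the hyperedges avoids this majority
altogether, although the cell depends on six sampled hyperedges only. -/
theorem card_heavy_samples {V E T : Type*} [LinearOrder T] [LinearOrder V] [Finite V] [Fintype E]
    {edge : E → Set V} {α : E → E → V → T} (hmono : ∀ e f, Monotone (α e f))
    (hcomp : ∀ e f k, (∀ u, α e f u = k → u ∈ edge e → u ∈ edge f) ∨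
      (∀ u, α e f u = k → u ∈ edge f → u ∈ edge e))
    {s : ℕ} (hs : 2 * (s ^ 6 * 2 ^ 6) ≤ 2 ^ s) (hs0 : 0 < s) (v : V) :
    2 * (Finset.univ.filter fun σ : Fin s → E => Fintype.card E <
      2 * (splittingEdges edge (sampleCell edge α σ v) v).card).card ≤ Fintype.card E ^ s := by
  have : Nonempty (Fin s) := ⟨⟨0, hs0⟩⟩
  set D : (Fin 6 → E) → Finset E := fun q => splittingEdges edge (sixEdgeCell edge α q v) v
  set B := Finset.univ.filter fun σ : Fin s → E => Fintype.card E <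
      2 * (splittingEdges edge (sampleCell edge α σ v) v).card
  have hsub : B ⊆ Finset.univ.biUnion fun p : Fin 6 → Fin s =>
      Finset.univ.filter fun σ : Fin s → E =>
        Fintype.card E < 2 * (D (σ ∘ p)).card ∧ ∀ j, σ j ∉ D (σ ∘ p) := by
    intro σ hσ
    obtain ⟨p, hp⟩ := exists_sampleCell_eq hmono hcomp σ v
    have hσ' := (Finset.mem_filter.1 hσ).2
    rw [hp] at hσ'
    refine Finset.mem_biUnion.2 ⟨p, Finset.mem_univ _,
      Finset.mem_filter.2 ⟨Finset.mem_univ _, hσ', fun j hj => ?_⟩⟩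
    obtain ⟨u, hu, hne⟩ := mem_splittingEdges.1 hj
    rw [← hp] at hu
    exact hne (hu.2 j)
  have hle : B.card * 2 ^ s ≤ s ^ 6 * (2 ^ 6 * Fintype.card E ^ s) := by
    calc B.card * 2 ^ s ≤ (∑ p : Fin 6 → Fin s, (Finset.univ.filter fun σ : Fin s → E =>
          Fintype.card E < 2 * (D (σ ∘ p)).card ∧ ∀ j, σ j ∉ D (σ ∘ p)).card) * 2 ^ s :=
          Nat.mul_le_mul_right _ ((Finset.card_le_card hsub).trans Finset.card_biUnion_le)
      _ ≤ ∑ _p : Fin 6 → Fin s, 2 ^ 6 * Fintype.card E ^ s := by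
          rw [Finset.sum_mul]
          exact Finset.sum_le_sum fun p _ => card_samples_missing D p
      _ = s ^ 6 * (2 ^ 6 * Fintype.card E ^ s) := by
          simp
  refine Nat.le_of_mul_le_mul_right ?_ (pow_pos two_pos s : 0 < 2 ^ s)
  calc 2 * B.card * 2 ^ s = 2 * (B.card * 2 ^ s) := mul_assoc _ _ _
    _ ≤ 2 * (s ^ 6 * (2 ^ 6 * Fintype.card E ^ s)) := Nat.mul_le_mul_left 2 hle
    _ = Fintype.card E ^ s * (2 * (s ^ 6 * 2 ^ 6)) := by ring
    _ ≤ Fintype.card E ^ s * 2 ^ s := Nat.mul_le_mul_left _ hs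

/-! ### Large homogeneous pairs -/

/-- An upper bound for the number of cells of a sample of `64` hyperedges. -/
def cellBound (t : ℕ) : ℕ := (t + 1) ^ (64 * 64) * 2 ^ 64

theorem cellBound_pos (t : ℕ) : 0 < cellBound t := by
  unfold cellBound
  positivity

theorem exists_homogeneous_of_isABFree {V E : Type*} [Fintype V] [Fintype E] {t n : ℕ}
    (H : MultiHypergraph V E) (hV : Fintype.card V = n) (hE : Fintype.card E = n)
    (hH : H.IsABFree t) :
    ∃ (V₀ : Finset V) (E₀ : Finset E), n ≤ 4 * cellBound t * V₀.card ∧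
      n ≤ 4 * cellBound t * E₀.card ∧
      ((∀ v ∈ V₀, ∀ e ∈ E₀, v ∈ H.edge e) ∨ (∀ v ∈ V₀, ∀ e ∈ E₀, v ∉ H.edge e)) := by
  classical
  rcases Nat.eq_zero_or_pos n with rfl | hn
  · exact ⟨∅, ∅, by simp, by simp, by simp⟩
  obtain ⟨hord, hfree⟩ := hH
  have hlevel : ∀ e f, ∃ α : V → Fin (t + 1), Monotone α ∧
      ∀ k, (∀ u, α u = k → u ∈ H.edge e → u ∈ H.edge f) ∨
        (∀ u, α u = k → u ∈ H.edge f → u ∈ H.edge e) := by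
    intro e f
    by_cases hef : e = f
    · exact ⟨fun _ => 0, monotone_const, fun _ => Or.inl fun u _ hu => hef ▸ hu⟩
    · exact exists_monotone_level fun h => hfree ⟨e, f, hef, h⟩
  choose α hmono hcomp using hlevel
  have : Nonempty E := Fintype.card_pos_iff.1 (hE ▸ hn)
  let heavy : (Fin 64 → E) → V → Prop := fun σ v =>
    Fintype.card E < 2 * (splittingEdges H.edge (sampleCell H.edge α σ v) v).card
  -- Averaging over all samples: some sample is bad for at most half of the vertices.
  obtain ⟨σ, hσ⟩ : ∃ σ : Fin 64 → E, 2 * (Finset.univ.filter fun v => heavy σ v).card ≤ n := by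
    by_contra! hcon
    have h1 : ∑ σ : Fin 64 → E, n < ∑ σ : Fin 64 → E,
        2 * (Finset.univ.filter fun v => heavy σ v).card :=
      Finset.sum_lt_sum_of_nonempty Finset.univ_nonempty fun σ _ => hcon σ
    have h2 : ∑ σ : Fin 64 → E, (Finset.univ.filter fun v => heavy σ v).card =
        ∑ v : V, (Finset.univ.filter fun σ => heavy σ v).card :=
      Finset.sum_card_bipartiteAbove_eq_sum_card_bipartiteBelow heavy
    have h3 : ∑ v : V, 2 * (Finset.univ.filter fun σ => heavy σ v).card ≤
        ∑ _v : V, Fintype.card E ^ 64 :=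
      Finset.sum_le_sum fun v _ =>
        card_heavy_samples hmono hcomp (by norm_num) (by norm_num) v
    rw [← Finset.mul_sum, h2, Finset.mul_sum] at h1
    have h4 := h1.trans_le h3
    simp only [Finset.sum_const, Finset.card_univ, Fintype.card_fun, Fintype.card_fin, smul_eq_mul,
      hV, hE] at h4
    exact absurd h4 (by rw [mul_comm]; exact lt_irrefl _)
  set B := Finset.univ.filter fun v => heavy σ v
  have hB : n ≤ 2 * Bᶜ.card := by
    have h := Finset.card_add_card_compl B
    omega
  let profile : V → (Fin 64 → Fin 64 → Fin (t + 1)) × (Fin 64 → Bool) := fun v =>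
    (fun i j => α (σ i) (σ j) v, fun i => decide (v ∈ H.edge (σ i)))
  obtain ⟨y, hy⟩ : ∃ y, n ≤ 2 * cellBound t * (Bᶜ.filter fun v => profile v = y).card := by
    by_contra! hcon
    have h1 := Finset.card_eq_sum_card_fiberwise (s := Bᶜ) (f := profile) (t := Finset.univ)
      fun _ _ => Finset.mem_coe.2 (Finset.mem_univ _)
    have hcard : Fintype.card ((Fin 64 → Fin 64 → Fin (t + 1)) × (Fin 64 → Bool)) =
        cellBound t := by
      simp only [Fintype.card_prod, Fintype.card_fun, Fintype.card_fin, Fintype.card_bool,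
        cellBound, ← pow_mul]
    have h2 : ∑ y, 2 * cellBound t * (Bᶜ.filter fun v => profile v = y).card <
        ∑ _y : (Fin 64 → Fin 64 → Fin (t + 1)) × (Fin 64 → Bool), n :=
      Finset.sum_lt_sum_of_nonempty Finset.univ_nonempty fun y _ => hcon y
    rw [← Finset.mul_sum, ← h1, Finset.sum_const, Finset.card_univ, hcard, smul_eq_mul] at h2
    have h3 := Nat.mul_le_mul_left (cellBound t) hB
    refine absurd h2 (not_lt.2 (h3.trans_eq ?_))
    ring
  set V₀ := Bᶜ.filter fun v => profile v = y
  obtain ⟨v, hv⟩ : V₀.Nonempty := by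
    by_contra h0
    rw [Finset.not_nonempty_iff_eq_empty.1 h0, Finset.card_empty, mul_zero] at hy
    omega
  have hcell : ∀ u ∈ V₀, u ∈ sampleCell H.edge α σ v := by
    intro u hu
    have h : profile u = profile v :=
      (Finset.mem_filter.1 hu).2.trans (Finset.mem_filter.1 hv).2.symm
    exact ⟨fun i j => congrFun (congrFun (congrArg Prod.fst h) i) j,
      fun i => decide_eq_decide.1 (congrFun (congrArg Prod.snd h) i)⟩
  set S := splittingEdges H.edge (sampleCell H.edge α σ v) v
  have hunsplit : ∀ e ∈ Sᶜ, ∀ u ∈ V₀, (u ∈ H.edge e ↔ v ∈ H.edge e) := by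
    intro e he u hu
    by_contra hne
    exact Finset.mem_compl.1 he
      (mem_splittingEdges.2 ⟨u, hcell u hu, hne⟩)
  have hSc : n ≤ 2 * Sᶜ.card := by
    have h1 : ¬ Fintype.card E < 2 * S.card := fun h =>
      Finset.mem_compl.1 (Finset.mem_filter.1 hv).1 (Finset.mem_filter.2 ⟨Finset.mem_univ v, h⟩)
    have h2 := Finset.card_add_card_compl S
    omega
  have hN : 1 ≤ cellBound t := cellBound_pos t
  have hV₀ : n ≤ 4 * cellBound t * V₀.card :=
    hy.trans (Nat.mul_le_mul_right _ (Nat.mul_le_mul_right _ (by norm_num)))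
  have hlarge : ∀ E₀ : Finset E, Sᶜ.card ≤ 2 * E₀.card → n ≤ 4 * cellBound t * E₀.card := by
    intro E₀ h
    have := Nat.mul_le_mul_right (4 * E₀.card) hN
    calc n ≤ 1 * (4 * E₀.card) := by omega
      _ ≤ cellBound t * (4 * E₀.card) := this
      _ = 4 * cellBound t * E₀.card := by ring
  have hsplit := Finset.card_filter_add_card_filter_not (s := Sᶜ) fun e => v ∈ H.edge e
  rcases le_total (Sᶜ.filter fun e => v ∉ H.edge e).card
    (Sᶜ.filter fun e => v ∈ H.edge e).card with hle | hle
  · refine ⟨V₀, Sᶜ.filter fun e => v ∈ H.edge e, hV₀, hlarge _ (by omega), Or.inl ?_⟩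
    intro u hu e he
    obtain ⟨he1, he2⟩ := Finset.mem_filter.1 he
    exact (hunsplit e he1 u hu).2 he2
  · refine ⟨V₀, Sᶜ.filter fun e => v ∉ H.edge e, hV₀, hlarge _ (by omega), Or.inr ?_⟩
    intro u hu e he hue
    obtain ⟨he1, he2⟩ := Finset.mem_filter.1 he
    exact he2 ((hunsplit e he1 u hu).1 hue)

theorem corollary3 (t : ℕ) :
    ∃ c : ℝ, 0 < c ∧
      ∀ (n : ℕ) (V : Type*) (E : Type*) [Fintype V] [Fintype E] (H : MultiHypergraph V E),
        Fintype.card V = n → Fintype.card E = n →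
        (H.IsABFree t ∨ H.IsDualABFree t) →
        ∃ (V₀ : Finset V) (E₀ : Finset E),
          c * (n : ℝ) ≤ (V₀.card : ℝ) ∧ c * (n : ℝ) ≤ (E₀.card : ℝ) ∧
          ((∀ v ∈ V₀, ∀ e ∈ E₀, v ∈ H.edge e) ∨ (∀ v ∈ V₀, ∀ e ∈ E₀, v ∉ H.edge e)) := by
  have hN : 0 < 4 * cellBound t :=
    Nat.mul_pos four_pos (cellBound_pos t)
  have hN' : (0 : ℝ) < ((4 * cellBound t : ℕ) : ℝ) := Nat.cast_pos.2 hN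
  refine ⟨((4 * cellBound t : ℕ) : ℝ)⁻¹, inv_pos.2 hN', fun n V E _ _ H hV hE hH => ?_⟩
  have hcast : ∀ m : ℕ, n ≤ 4 * cellBound t * m →
      ((4 * cellBound t : ℕ) : ℝ)⁻¹ * (n : ℝ) ≤ (m : ℝ) := fun m hm =>
    (inv_mul_le_iff₀ hN').2 (by rw [← Nat.cast_mul]; exact Nat.cast_le.2 hm)
  rcases hH with hH | hH
  · obtain ⟨V₀, E₀, h1, h2, h3⟩ := exists_homogeneous_of_isABFree H hV hE hH
    exact ⟨V₀, E₀, hcast _ h1, hcast _ h2, h3⟩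
  · obtain ⟨E₀, V₀, h1, h2, h3⟩ := exists_homogeneous_of_isABFree H.dual hE hV hH
    exact ⟨V₀, E₀, hcast _ h2, hcast _ h1, h3.imp (fun h v hv e he => h e he v hv)
      fun h v hv e he => h e he v hv⟩
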